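/- Let $r>0$ and let $S$ be a set of points of the Euclidean plane. The closed disks of radius $r$ centred at the points of $S$ form a two-fold covering if every point of the plane lies in at least two of them. The Voronoi polygon of $a\in S$ is $V(a)=\{x : d(x,a)\le d(x,b)\text{ for all } b\in S\}$, and $S$ satisfies the congruent Voronoi triangle condition if all the sets $V(a)$, $a\in S$, are (nondegenerate) triangles congruent to one another. The covering density is the ratio of the total area of the disks to the total area of the Voronoi polygons, that is, the limit as $R\to\infty$ of this ratio taken over the centres $a\in S$ with $|a|\le R$. Let $\vartheta=\pi/A_6$, where $A_6$ is the area of the regular hexagon inscribed in a unit circle (by Kershner's theorem, which is not part of the claim, $\vartheta$ is the minimum density of a one-fold covering of the plane by equal disks). Then $2\vartheta=\frac{4\pi}{\sqrt{27}}$, and for every $r>0$: every two-fold covering by disks of radius $r$ that satisfies the congruent Voronoi triangle condition has a covering density, and the minimum of these densities is $2\vartheta$. The minimum is attained by the pattern of Johnson circles with equilateral triangles, in which, for each centre $a$, the Voronoi polygon $V(a)$ is an equilateral triangle $ABC$ inscribed in the circle of radius $r$ about $a$, and three circles of radius $r$ of the pattern pass through a common point $Q$ and meet pairwise a second time in $A$,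 $B$ and $C$: two-fold coverings of this form exist for every $r>0$, and each of them satisfies the congruent Voronoi triangle condition and has covering density $2\vartheta$. -/

import Mathlib

open Set Filter Topology MeasureTheory
open scoped ENNReal

/-- The Euclidean plane. -/
abbrev Plane : Type := EuclideanSpace ℝ (Fin 2)

/-- The equal closed disks of radius `r` centred at the points of `S` form a `k`-fold covering:
every point of the plane lies in at least `k` of them. -/
def IsFoldCovering (k : ℕ) (S : Set Plane) (r : ℝ) : Prop :=
  ∀ x : Plane, (k : ℕ∞) ≤ {a : Plane | a ∈ S ∧ x ∈ Metric.closedBall a r}.encard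

/-- The Voronoi polygon of the centre `a` in the set of centres `S`. -/
def voronoiCell (S : Set Plane) (a : Plane) : Set Plane :=
  {x | ∀ b ∈ S, dist x a ≤ dist x b}

/-- A set is a (nondegenerate, filled) triangle. -/
def IsTriangle (T : Set Plane) : Prop :=
  ∃ A B C : Plane, AffineIndependent ℝ ![A, B, C] ∧ T = convexHull ℝ {A, B, C}

/-- Two plane sets are congruent: an isometry of the plane (rotation, translation or reflection)
carries one onto the other. -/
def AreCongruent (T U : Set Plane) : Prop :=
  ∃ e : Plane ≃ᵢ Plane, e '' T = U

/-- All Voronoi polygons of `S` are triangles, and they are pairwise congruent. -/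
def HasCongruentVoronoiTriangles (S : Set Plane) : Prop :=
  (∀ a ∈ S, IsTriangle (voronoiCell S a)) ∧
    ∀ a ∈ S, ∀ b ∈ S, AreCongruent (voronoiCell S a) (voronoiCell S b)

/-- The ratio of the total area of the disks to the total area of the Voronoi polygons, both
taken over the centres at distance at most `R` from the origin. -/
noncomputable def densityRatio (S : Set Plane) (r R : ℝ) : ℝ≥0∞ :=
  (∑' a : ↥(S ∩ Metric.closedBall (0 : Plane) R), volume (Metric.closedBall (a : Plane) r)) /
    (∑' a : ↥(S ∩ Metric.closedBall (0 : Plane) R), volume (voronoiCell S (a : Plane)))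

/-- The covering density of the disks of radius `r` centred at `S` exists and equals `D`: the
ratio of the total area of the disks to the total area of the Voronoi polygons tends to `D`. -/
def HasCoveringDensity (S : Set Plane) (r : ℝ) (D : ℝ≥0∞) : Prop :=
  Tendsto (densityRatio S r) atTop (𝓝 D)

/-- The regular hexagon inscribed in the unit circle. -/
noncomputable def regularHexagon : Set Plane :=
  convexHull ℝ (range fun k : Fin 6 =>
    (!₂[Real.cos ((k : ℕ) * (Real.pi / 3)), Real.sin ((k : ℕ) * (Real.pi / 3))] : Plane))

/-- The constant `ϑ = π / A₆`, where `A₆` is the area of the regular hexagon inscribed in the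
unit circle: the density of the thinnest one-fold covering by equal disks. -/
noncomputable def theta : ℝ :=
  Real.pi / (volume regularHexagon).toReal

/-- The pattern of Johnson circles with equilateral triangles: for each centre `a`, the Voronoi
polygon of `a` is an equilateral triangle `ABC` inscribed in the circle about `a`, and three
circles of the pattern pass through one point `Q` and meet pairwise again in `A`, `B`, `C`. -/
def IsEquilateralJohnsonPattern (S : Set Plane) (r : ℝ) : Prop :=
  ∀ a ∈ S, ∃ A B C Q : Plane, ∃ c₁ ∈ S, ∃ c₂ ∈ S, ∃ c₃ ∈ S,
    AffineIndependent ℝ ![A, B, C] ∧ voronoiCell S a = convexHull ℝ {A, B, C} ∧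
    dist A B = dist B C ∧ dist B C = dist C A ∧
    A ∈ Metric.sphere a r ∧ B ∈ Metric.sphere a r ∧ C ∈ Metric.sphere a r ∧
    Q ≠ A ∧ Q ≠ B ∧ Q ≠ C ∧
    Metric.sphere c₂ r ∩ Metric.sphere c₃ r = {Q, A} ∧
    Metric.sphere c₃ r ∩ Metric.sphere c₁ r = {Q, B} ∧
    Metric.sphere c₁ r ∩ Metric.sphere c₂ r = {Q, C}

/-! In a covering every point has a centre within `r`, so each Voronoi cell lies in the disk about
its own centre. Distinct cells overlap in null sets and congruent cells share an area `v`, so the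
density ratio is constantly `π r² / v` once a centre is counted
(`IsFoldCovering.hasCoveringDensity`). A triangle in a disk of radius `r` has at most the area of
the inscribed equilateral triangle (`abs_doubleArea_le`), which is half the inscribed regular
hexagon; hence the bound `2ϑ`, with equality for Johnson patterns.

For existence, colour the triangular lattice of side `r` by `i - j` mod 3 and delete one colour.
Every lattice triangle has one vertex of each colour, so two of its vertices remain, each within `r`
of all its points: the covering is two-fold. The cell of a remaining point is the triangle of its
three deleted neighbours, and the circles about its three remaining neighbours all pass through it.
-/

/-! ### Triangles in coordinates -/

/-- Twice the signed area of the triangle `ABC`. -/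
noncomputable def doubleArea (A B C : Plane) : ℝ :=
  (B 0 - A 0) * (C 1 - A 1) - (B 1 - A 1) * (C 0 - A 0)

lemma affineIndependent_iff_doubleArea_ne_zero (A B C : Plane) :
    AffineIndependent ℝ ![A, B, C] ↔ doubleArea A B C ≠ 0 := by
  constructor
  · intro h h0
    rw [affineIndependent_iff] at h
    have key : ∀ s t : ℝ, s * (B 0 - A 0) + t * (C 0 - A 0) = 0 →
        s * (B 1 - A 1) + t * (C 1 - A 1) = 0 → s = 0 ∧ t = 0 := by
      intro s t h1 h2
      have := h Finset.univ ![-s - t, s, t] (by simp only [Fin.sum_univ_three, Matrix.cons_val]; ring)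
        (by
          ext i
          fin_cases i <;> simp [Fin.sum_univ_three] <;> linarith)
      exact ⟨this 1 (Finset.mem_univ _), this 2 (Finset.mem_univ _)⟩
    unfold doubleArea at h0
    -- When the determinant vanishes, its cofactors are coefficients of a dependence between the two
    -- sides, so all side coordinates vanish; then `1, 0` is a nontrivial dependence.
    obtain ⟨h1, h2⟩ := key (C 1 - A 1) (-(B 1 - A 1)) (by linarith) (by ring)
    obtain ⟨h3, h4⟩ := key (C 0 - A 0) (-(B 0 - A 0)) (by ring) (by linarith)
    exact one_ne_zero (key 1 0 (by linarith) (by linarith)).1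
  · intro h
    rw [affineIndependent_iff_of_fintype]
    intro w hw h0
    rw [Finset.weightedVSub_eq_linear_combination _ hw] at h0
    have e0 := congrArg (fun x : Plane => x 0) h0
    have e1 := congrArg (fun x : Plane => x 1) h0
    simp only [Fin.sum_univ_three, Matrix.cons_val, PiLp.add_apply, PiLp.smul_apply, smul_eq_mul,
      PiLp.zero_apply] at e0 e1 hw
    have hw0 : w 0 = -w 1 - w 2 := by linarith
    have h1 : w 1 * doubleArea A B C = 0 := by
      unfold doubleArea
      rw [hw0] at e0 e1
      linear_combination (C 1 - A 1) * e0 - (C 0 - A 0) * e1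
    have h2 : w 2 * doubleArea A B C = 0 := by
      unfold doubleArea
      rw [hw0] at e0 e1
      linear_combination (B 0 - A 0) * e1 - (B 1 - A 1) * e0
    have h1 := (mul_eq_zero.1 h1).resolve_right h
    have h2 := (mul_eq_zero.1 h2).resolve_right h
    intro i
    fin_cases i
    · simpa [h1, h2] using hw0
    · exact h1
    · exact h2

lemma mem_convexHull_triple {E : Type*} [AddCommGroup E] [Module ℝ E] {A B C x : E} :
    x ∈ convexHull ℝ {A, B, C} ↔
      ∃ s t : ℝ, 0 ≤ s ∧ 0 ≤ t ∧ s + t ≤ 1 ∧ x = A + (s • (B - A) + t • (C - A)) := by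
  constructor
  · intro h
    have hc : Convex ℝ {x : E | ∃ s t : ℝ, 0 ≤ s ∧ 0 ≤ t ∧ s + t ≤ 1 ∧
        x = A + (s • (B - A) + t • (C - A))} := by
      rintro _ ⟨s, t, hs, ht, hst, rfl⟩ _ ⟨s', t', hs', ht', hst', rfl⟩ a b ha hb hab
      refine ⟨a * s + b * s', a * t + b * t', by positivity, by positivity, ?_, ?_⟩
      · nlinarith
      · have : a = 1 - b := by linarith
        subst this
        module
    refine convexHull_min ?_ hc h
    rintro y (rfl | rfl | rfl)
    · exact ⟨0, 0, by simp⟩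
    · exact ⟨1, 0, by simp⟩
    · exact ⟨0, 1, by simp⟩
  · rintro ⟨s, t, hs, ht, hst, rfl⟩
    have hmem : ∀ y ∈ ({A, B, C} : Set E), y ∈ convexHull ℝ {A, B, C} := subset_convexHull ℝ _
    have := (convex_convexHull ℝ ({A, B, C} : Set E)).sum_mem (t := Finset.univ)
      (w := ![1 - s - t, s, t]) (z := ![A, B, C])
      (by
        intro i _
        fin_cases i
        · simp only [Fin.zero_eta, Matrix.cons_val_zero]; linarith
        · exact hs
        · exact ht)
      (by simp only [Fin.sum_univ_three, Matrix.cons_val]; ring)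
      (by intro i _; fin_cases i <;> exact hmem _ (by simp))
    simp only [Fin.sum_univ_three, Matrix.cons_val] at this
    convert this using 1
    module

/-- The area of a plane region bounded by graphs over the second coordinate. -/
lemma volume_setOf_slices {a b : ℝ} (hab : a ≤ b) {f g : ℝ → ℝ} (hf : Continuous f)
    (hg : Continuous g) (hfg : ∀ y ∈ Icc a b, f y ≤ g y) :
    volume {x : Plane | x 1 ∈ Icc a b ∧ x 0 ∈ Icc (f (x 1)) (g (x 1))} =
      ENNReal.ofReal (∫ y in a..b, (g y - f y)) := by
  set T : Set (ℝ × ℝ) := {p | p.2 ∈ Icc a b ∧ p.1 ∈ Icc (f p.2) (g p.2)} with hT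
  have hTm : MeasurableSet T := by
    refine IsClosed.measurableSet ?_
    simp only [hT, mem_Icc, ofPred_and]
    refine ((isClosed_le ?_ ?_).inter (isClosed_le ?_ ?_)).inter
      ((isClosed_le ?_ ?_).inter (isClosed_le ?_ ?_)) <;> fun_prop
  have h1 : {x : Plane | x 1 ∈ Icc a b ∧ x 0 ∈ Icc (f (x 1)) (g (x 1))} =
      (WithLp.ofLp : Plane → _) ⁻¹' (MeasurableEquiv.finTwoArrow ⁻¹' T) := by
    ext x
    simp [hT, MeasurableEquiv.finTwoArrow]
  rw [h1, (PiLp.volume_preserving_ofLp (Fin 2)).measure_preimage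
      ((MeasurableEquiv.finTwoArrow.measurable hTm).nullMeasurableSet),
    (volume_preserving_finTwoArrow ℝ).measure_preimage hTm.nullMeasurableSet,
    Measure.volume_eq_prod, Measure.prod_apply_symm hTm]
  have h2 : ∀ y, volume ((fun x : ℝ => (x, y)) ⁻¹' T) =
      (Icc a b).indicator (fun y => ENNReal.ofReal (g y - f y)) y := by
    intro y
    by_cases hy : y ∈ Icc a b
    · have : (fun x : ℝ => (x, y)) ⁻¹' T = Icc (f y) (g y) := by
        ext x; simp only [hT, mem_preimage, mem_ofPred_eq]; tauto
      rw [this, Real.volume_Icc, indicator_of_mem hy]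
    · have : (fun x : ℝ => (x, y)) ⁻¹' T = ∅ := by
        ext x; simp only [hT, mem_preimage, mem_ofPred_eq, mem_empty_iff_false]; tauto
      rw [this, measure_empty, indicator_of_notMem hy]
  simp_rw [h2]
  rw [lintegral_indicator measurableSet_Icc, intervalIntegral.integral_of_le hab,
    ← integral_Icc_eq_integral_Ioc, ofReal_integral_eq_lintegral_ofReal]
  · exact (hg.sub hf).continuousOn.integrableOn_Icc
  · filter_upwards [ae_restrict_mem measurableSet_Icc] with y hy
    have := hfg y hy
    simp only [Pi.zero_apply]; linarith

lemma volume_standardTriangle :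
    volume {x : Plane | 0 ≤ x 0 ∧ 0 ≤ x 1 ∧ x 0 + x 1 ≤ 1} = ENNReal.ofReal (1 / 2) := by
  have h := volume_setOf_slices (a := 0) (b := 1) zero_le_one (f := fun _ => 0)
    (g := fun y => 1 - y) (by fun_prop) (by fun_prop) (by intro y hy; linarith [hy.2])
  have h2 : ∫ y in (0 : ℝ)..1, ((1 - y) - 0) = 1 / 2 := by
    simp only [sub_zero]
    rw [intervalIntegral.integral_sub (by simp) (by simp)]
    norm_num
  rw [← h2, ← h]
  congr 1
  ext x
  simp only [mem_ofPred_eq, mem_Icc]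
  constructor
  · rintro ⟨h1, h2, h3⟩; exact ⟨⟨h2, by linarith⟩, h1, by linarith⟩
  · rintro ⟨⟨h1, h2⟩, h3, h4⟩; exact ⟨h3, h1, by linarith⟩

/-- The area of a triangle. -/
lemma volume_triangle (A B C : Plane) :
    volume (convexHull ℝ {A, B, C}) = ENNReal.ofReal (|doubleArea A B C| / 2) := by
  set M : Matrix (Fin 2) (Fin 2) ℝ := !![B 0 - A 0, C 0 - A 0; B 1 - A 1, C 1 - A 1] with hM
  set L : Plane →ₗ[ℝ] Plane := Matrix.toLpLin 2 2 M with hL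
  have hdet : LinearMap.det L = doubleArea A B C := by
    have : LinearMap.det L = M.det := by
      rw [hL, Matrix.toLpLin_eq_toLin, LinearMap.det_toLin]
    rw [this, hM, Matrix.det_fin_two_of, doubleArea]; ring
  have hset : convexHull ℝ {A, B, C} =
      (fun x => A + x) '' (L '' {x : Plane | 0 ≤ x 0 ∧ 0 ≤ x 1 ∧ x 0 + x 1 ≤ 1}) := by
    have hLx : ∀ x : Plane, L x = x 0 • (B - A) + x 1 • (C - A) := by
      intro x
      ext i
      fin_cases i <;> simp [hL, hM, Matrix.toLpLin_apply, dotProduct] <;> ring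
    ext x
    rw [mem_convexHull_triple, image_image]
    constructor
    · rintro ⟨s, t, hs, ht, hst, rfl⟩
      exact ⟨!₂[s, t], by simpa using ⟨hs, ht, hst⟩, by simp [hLx]⟩
    · rintro ⟨y, ⟨h0, h1, h2⟩, rfl⟩
      exact ⟨y 0, y 1, h0, h1, h2, by simp only [hLx]⟩
  rw [hset, image_add_left, measure_preimage_add, Measure.addHaar_image_linearMap,
    volume_standardTriangle, hdet, ← ENNReal.ofReal_mul (abs_nonneg _)]
  congr 1; ring

lemma dist_sq_eq (x y : Plane) : dist x y ^ 2 = (x 0 - y 0) ^ 2 + (x 1 - y 1) ^ 2 := by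
  rw [EuclideanSpace.dist_eq, Real.sq_sqrt (by positivity), Fin.sum_univ_two, Real.dist_eq,
    Real.dist_eq, sq_abs, sq_abs]

lemma dist_le_dist_iff (x y z w : Plane) :
    dist x y ≤ dist z w ↔
      (x 0 - y 0) ^ 2 + (x 1 - y 1) ^ 2 ≤ (z 0 - w 0) ^ 2 + (z 1 - w 1) ^ 2 := by
  rw [← dist_sq_eq, ← dist_sq_eq, sq_le_sq₀ dist_nonneg dist_nonneg]

/-- A triangle contained in a disk of radius `r` has at most the area of the inscribed equilateral
triangle. -/
lemma abs_doubleArea_le {A B C O : Plane} {r : ℝ} (hA : dist A O ≤ r)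
    (hB : dist B O ≤ r) (hC : dist C O ≤ r) :
    |doubleArea A B C| ≤ 3 * √3 / 2 * r ^ 2 := by
  have hr : 0 ≤ r := dist_nonneg.trans hA
  rw [← sq_le_sq₀ dist_nonneg hr, dist_sq_eq] at hA hB hC
  have h3 : √3 ^ 2 = 3 := Real.sq_sqrt (by norm_num)
  have hs : 0 < √3 := by positivity
  unfold doubleArea
  obtain ⟨a, ha⟩ : ∃ a, A 0 - O 0 = a := ⟨_, rfl⟩
  obtain ⟨a', ha'⟩ : ∃ a, A 1 - O 1 = a := ⟨_, rfl⟩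
  obtain ⟨b, hb⟩ : ∃ a, B 0 - O 0 = a := ⟨_, rfl⟩
  obtain ⟨b', hb'⟩ : ∃ a, B 1 - O 1 = a := ⟨_, rfl⟩
  obtain ⟨c, hc⟩ : ∃ a, C 0 - O 0 = a := ⟨_, rfl⟩
  obtain ⟨c', hc'⟩ : ∃ a, C 1 - O 1 = a := ⟨_, rfl⟩
  rw [ha, ha'] at hA
  rw [hb, hb'] at hB
  rw [hc, hc'] at hC
  rw [show B 0 - A 0 = b - a by linarith, show B 1 - A 1 = b' - a' by linarith,
    show C 0 - A 0 = c - a by linarith, show C 1 - A 1 = c' - a' by linarith]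
  -- The left side is half the sum of the squared sides, and that sum is three times the sum of the
  -- squared radius vectors minus the square of their vector sum.
  have hsum : (b - a) ^ 2 + (b' - a') ^ 2 + ((c - a) ^ 2 + (c' - a') ^ 2) -
      ((b - a) * (c - a) + (b' - a') * (c' - a')) ≤ 9 / 2 * r ^ 2 := by
    nlinarith [sq_nonneg (a + b + c), sq_nonneg (a' + b' + c')]
  have key : ∀ D : ℝ, √3 * D ≤ 9 / 2 * r ^ 2 → D ≤ 3 * √3 / 2 * r ^ 2 := by
    intro D hD
    refine le_of_mul_le_mul_left ?_ hs
    calc √3 * D ≤ 9 / 2 * r ^ 2 := hD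
      _ = √3 * (3 * √3 / 2 * r ^ 2) := by linear_combination (-3 / 2 * r ^ 2) * h3
  -- Weitzenböck's inequality: the difference of the two sides is the squared distance between `B -
  -- A` and `C - A` turned by 60°. The sign of `σ` is the direction of the turn.
  have hW : ∀ σ : ℝ, σ ^ 2 = 3 →
      σ * ((b - a) * (c' - a') - (b' - a') * (c - a)) ≤ 9 / 2 * r ^ 2 := by
    intro σ hσ
    refine le_trans ?_ hsum
    nlinarith [sq_nonneg ((b - a) - ((c - a) + σ * (c' - a')) / 2),
      sq_nonneg ((b' - a') - ((c' - a') - σ * (c - a)) / 2)]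
  refine abs_le'.2 ⟨key _ (hW _ h3), key _ ?_⟩
  have := hW (-√3) (by rw [neg_sq, h3])
  linarith

lemma sq_add_sq_eq_of_equilateral_inscribed {a a' b b' c c' R : ℝ}
    (hi : (b - a) * (c' - a') - (b' - a') * (c - a) ≠ 0)
    (h₁ : (a - b) ^ 2 + (a' - b') ^ 2 = (b - c) ^ 2 + (b' - c') ^ 2)
    (h₂ : (b - c) ^ 2 + (b' - c') ^ 2 = (c - a) ^ 2 + (c' - a') ^ 2)
    (hA : a ^ 2 + a' ^ 2 = R) (hB : b ^ 2 + b' ^ 2 = R) (hC : c ^ 2 + c' ^ 2 = R) :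
    (a - b) ^ 2 + (a' - b') ^ 2 = 3 * R := by
  -- the sum of the radius vectors is orthogonal to two independent sides, hence vanishes
  have s1 : (a + b + c) * (b - a) + (a' + b' + c') * (b' - a') = 0 := by
    linear_combination 3 / 2 * (hB - hA) - h₂ / 2
  have s2 : (a + b + c) * (c - a) + (a' + b' + c') * (c' - a') = 0 := by
    linear_combination 3 / 2 * (hC - hA) + h₁ / 2
  have s0 : a + b + c = 0 := by
    refine (mul_eq_zero.1 ?_).resolve_right hi
    linear_combination (c' - a') * s1 - (b' - a') * s2
  have s0' : a' + b' + c' = 0 := by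
    refine (mul_eq_zero.1 ?_).resolve_right hi
    linear_combination (b - a) * s2 - (c - a) * s1
  -- Parallelogram law for `A` and `B`, whose sum is `-C` as seen from the circumcentre.
  linear_combination 2 * hA + 2 * hB - hC + (c - a - b) * s0 + (c' - a' - b') * s0'

/-- The side length of an equilateral triangle inscribed in a circle of radius `r`. -/
lemma dist_sq_eq_of_equilateral_inscribed {A B C O : Plane} {r : ℝ}
    (hi : AffineIndependent ℝ ![A, B, C]) (h₁ : dist A B = dist B C) (h₂ : dist B C = dist C A)
    (hA : dist A O = r) (hB : dist B O = r) (hC : dist C O = r) :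
    dist A B ^ 2 = 3 * r ^ 2 := by
  rw [affineIndependent_iff_doubleArea_ne_zero, doubleArea] at hi
  have h₁ : dist A B ^ 2 = dist B C ^ 2 := by rw [h₁]
  have h₂ : dist B C ^ 2 = dist C A ^ 2 := by rw [h₂]
  have hA : dist A O ^ 2 = r ^ 2 := by rw [hA]
  have hB : dist B O ^ 2 = r ^ 2 := by rw [hB]
  have hC : dist C O ^ 2 = r ^ 2 := by rw [hC]
  rw [dist_sq_eq] at *
  rw [dist_sq_eq] at h₁ h₂
  have := sq_add_sq_eq_of_equilateral_inscribed (a := A 0 - O 0) (a' := A 1 - O 1)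
    (b := B 0 - O 0) (b' := B 1 - O 1) (c := C 0 - O 0) (c' := C 1 - O 1) (R := r ^ 2)
    (by convert hi using 1; ring) (by linarith) (by linarith) hA hB hC
  linarith

/-- Lagrange's identity: the squared determinant is `|p|²|q|² - (p·q)²`, here `l² - l²/4`. -/
lemma abs_doubleArea_of_equilateral {A B C : Plane} {l : ℝ} (h₁ : dist A B ^ 2 = l)
    (h₂ : dist B C ^ 2 = l) (h₃ : dist C A ^ 2 = l) :
    |doubleArea A B C| = √3 / 2 * l := by
  have hl : 0 ≤ l := h₁ ▸ sq_nonneg _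
  have h3 : √3 ^ 2 = 3 := Real.sq_sqrt (by norm_num)
  rw [← abs_of_nonneg (show 0 ≤ √3 / 2 * l by positivity), ← sq_eq_sq_iff_abs_eq_abs, mul_pow,
    div_pow, h3, doubleArea]
  rw [dist_sq_eq] at h₁ h₂ h₃
  have hin : (B 0 - A 0) * (C 0 - A 0) + (B 1 - A 1) * (C 1 - A 1) = l / 2 := by linarith
  have hp : (B 0 - A 0) ^ 2 + (B 1 - A 1) ^ 2 = l := by linarith
  have hq : (C 0 - A 0) ^ 2 + (C 1 - A 1) ^ 2 = l := by linarith
  generalize B 0 - A 0 = p at *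
  generalize B 1 - A 1 = p' at *
  generalize C 0 - A 0 = q at *
  generalize C 1 - A 1 = q' at *
  linear_combination (q ^ 2 + q' ^ 2) * hp + l * hq -
    (p * q + p' * q' + l / 2) * hin

/-! ### Congruence -/

lemma IsometryEquiv.image_convexHull_plane (e : Plane ≃ᵢ Plane) (s : Set Plane) :
    e '' convexHull ℝ s = convexHull ℝ (e '' s) := by
  have := AffineMap.image_convexHull (e.toRealAffineIsometryEquiv.toAffineEquiv : Plane →ᵃ[ℝ] Plane) s
  simpa using this

/-- By Mazur–Ulam an isometry of the plane is a linear isometry followed by a translation. -/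
lemma AreCongruent.volume_eq {T U : Set Plane} (h : AreCongruent T U) : volume T = volume U := by
  obtain ⟨e, rfl⟩ := h
  have h1 : e '' T = (fun x => e 0 + x) '' (e.toRealLinearIsometryEquiv '' T) := by
    rw [image_image]
    refine image_congr fun x _ => ?_
    simp
  rw [h1, image_add_left, measure_preimage_add, LinearIsometryEquiv.image_eq_preimage_symm]
  exact ((LinearIsometryEquiv.measurePreserving _).measure_preimage_emb
    (LinearIsometryEquiv.toHomeomorph _).measurableEmbedding T).symm

lemma exists_isometryEquiv_of_equilateral {A B C : Plane} {l : ℝ} (hl : 0 < l)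
    (h₁ : dist A B ^ 2 = l) (h₂ : dist B C ^ 2 = l) (h₃ : dist C A ^ 2 = l) :
    ∃ e : Plane ≃ᵢ Plane, e '' {A, B, C} = {0, !₂[√l, 0], !₂[√l / 2, √3 / 2 * √l]} := by
  have hs : √l ^ 2 = l := Real.sq_sqrt hl.le
  have h3 : √3 ^ 2 = 3 := Real.sq_sqrt (by norm_num)
  have hsp : 0 < √l := Real.sqrt_pos.2 hl
  have h3p : 0 < √3 := by positivity
  rw [dist_sq_eq] at h₁ h₂ h₃
  have hin : ∀ x y : Plane, inner ℝ x y = x 0 * y 0 + x 1 * y 1 := by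
    intro x y
    simp [PiLp.inner_apply, Fin.sum_univ_two, mul_comm]
  set p := B - A with hp
  set q := C - A with hq
  have hpp : inner ℝ p p = l := by simp only [hin, hp, PiLp.sub_apply]; linarith
  have hqq : inner ℝ q q = l := by simp only [hin, hq, PiLp.sub_apply]; linarith
  have hpq : inner ℝ p q = l / 2 := by simp only [hin, hp, hq, PiLp.sub_apply]; linarith
  have hqp : inner ℝ q p = l / 2 := by rw [real_inner_comm, hpq]
  -- Gram–Schmidt on the sides: since `p·q = l/2`, the vector `2q - p` is orthogonal to `p` and has
  -- squared length `3l`.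
  set v : Fin 2 → Plane := ![(√l)⁻¹ • p, (√3 * √l)⁻¹ • ((2 : ℝ) • q - p)] with hv
  have hon : Orthonormal ℝ v := by
    rw [orthonormal_iff_ite]
    intro i j
    fin_cases i <;> fin_cases j <;>
      simp only [hv, Fin.zero_eta, Fin.mk_one, Matrix.cons_val, inner_smul_left, inner_smul_right,
        inner_sub_left, inner_sub_right, hpp, hqq, hpq, hqp, conj_trivial, Fin.isValue,
        zero_ne_one, one_ne_zero, if_true, if_false] <;> field_simp <;> (norm_num [hs, h3]; try ring)
  obtain ⟨b, hb⟩ := Orthonormal.exists_orthonormalBasis_extension_of_card_eq (ι := Fin 2)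
    (v := v) (s := univ) (by simp) (hon.comp _ Subtype.val_injective)
  have hb0 : b 0 = (√l)⁻¹ • p := hb 0 (mem_univ _)
  have hb1 : b 1 = (√3 * √l)⁻¹ • ((2 : ℝ) • q - p) := hb 1 (mem_univ _)
  refine ⟨(IsometryEquiv.subRight A).trans b.repr.toIsometryEquiv, ?_⟩
  rw [image_insert_eq, image_pair]
  have e0 : b.repr (A - A) = 0 := by simp
  have e1 : b.repr (B - A) = !₂[√l, 0] := by
    ext i
    rw [b.repr_apply_apply]
    fin_cases i
    · simp only [Fin.zero_eta, hb0, inner_smul_left, ← hp, hpp, conj_trivial]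
      simp; field_simp; exact hs.symm
    · simp only [Fin.mk_one, hb1, inner_smul_left, inner_sub_left, ← hp, hpp, hqp, conj_trivial]
      simp; right; ring
  have e2 : b.repr (C - A) = !₂[√l / 2, √3 / 2 * √l] := by
    ext i
    rw [b.repr_apply_apply]
    fin_cases i
    · simp only [Fin.zero_eta, hb0, inner_smul_left, ← hq, hpq, conj_trivial]
      simp; field_simp; exact hs.symm
    · simp only [Fin.mk_one, hb1, inner_smul_left, inner_sub_left, ← hq, hqq, hpq, conj_trivial]
      simp; field_simp; rw [h3, hs]; ring
  simp only [IsometryEquiv.trans_apply, IsometryEquiv.subRight_apply,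
    LinearIsometryEquiv.coe_toIsometryEquiv, e0, e1, e2]

lemma AreCongruent.symm {T U : Set Plane} (h : AreCongruent T U) : AreCongruent U T := by
  obtain ⟨e, rfl⟩ := h
  exact ⟨e.symm, by simp [image_image]⟩

lemma AreCongruent.trans {T U W : Set Plane} (h : AreCongruent T U) (h' : AreCongruent U W) :
    AreCongruent T W := by
  obtain ⟨e, rfl⟩ := h
  obtain ⟨f, rfl⟩ := h'
  exact ⟨e.trans f, by rw [image_image]; rfl⟩

lemma areCongruent_of_equilateral {A B C A' B' C' : Plane} {l : ℝ} (hl : 0 < l)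
    (h₁ : dist A B ^ 2 = l) (h₂ : dist B C ^ 2 = l) (h₃ : dist C A ^ 2 = l)
    (h₁' : dist A' B' ^ 2 = l) (h₂' : dist B' C' ^ 2 = l) (h₃' : dist C' A' ^ 2 = l) :
    AreCongruent (convexHull ℝ {A, B, C}) (convexHull ℝ {A', B', C'}) := by
  obtain ⟨e, he⟩ := exists_isometryEquiv_of_equilateral hl h₁ h₂ h₃
  obtain ⟨e', he'⟩ := exists_isometryEquiv_of_equilateral hl h₁' h₂' h₃'
  refine AreCongruent.trans ⟨e, e.image_convexHull_plane _⟩ (AreCongruent.symm ⟨e', ?_⟩)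
  rw [e'.image_convexHull_plane, he', he]

/-! ### Voronoi cells and the covering density -/

lemma isClosed_voronoiCell (S : Set Plane) (a : Plane) : IsClosed (voronoiCell S a) := by
  simp only [voronoiCell, ofPred_forall]
  exact isClosed_biInter fun b _ => isClosed_le (by fun_prop) (by fun_prop)

/-- Common points lie on the perpendicular bisector, a null line. -/
lemma aedisjoint_voronoiCell {S : Set Plane} {a b : Plane} (ha : a ∈ S) (hb : b ∈ S)
    (hab : a ≠ b) : AEDisjoint volume (voronoiCell S a) (voronoiCell S b) := by
  refine measure_mono_null ?_ (Measure.addHaar_affineSubspace volume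
    (AffineSubspace.perpBisector a b) (by rwa [Ne, AffineSubspace.perpBisector_eq_top]))
  rintro x ⟨hx, hx'⟩
  exact AffineSubspace.mem_perpBisector_iff_dist_eq.2 (le_antisymm (hx b hb) (hx' a ha))

lemma IsFoldCovering.exists_dist_le {k : ℕ} {S : Set Plane} {r : ℝ} (h : IsFoldCovering k S r)
    (hk : k ≠ 0) (x : Plane) : ∃ a ∈ S, dist x a ≤ r := by
  have hne : {a : Plane | a ∈ S ∧ x ∈ Metric.closedBall a r}.Nonempty := by
    rw [← encard_ne_zero]
    intro h0
    have := h x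
    rw [h0] at this
    exact hk (by simpa using this)
  exact hne

lemma IsFoldCovering.voronoiCell_subset {k : ℕ} {S : Set Plane} {r : ℝ}
    (h : IsFoldCovering k S r) (hk : k ≠ 0) (a : Plane) :
    voronoiCell S a ⊆ Metric.closedBall a r := by
  intro x hx
  obtain ⟨b, hb, hxb⟩ := h.exists_dist_le hk x
  exact (hx b hb).trans hxb

/-- The cells of these centres are almost disjoint, have equal positive area and fit in a disk of
radius `R + r`. Finiteness lets the number of centres cancel in the density ratio. -/
lemma IsFoldCovering.finite_inter_closedBall {k : ℕ} {S : Set Plane} {r : ℝ}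
    (h : IsFoldCovering k S r) (hk : k ≠ 0) {v : ℝ≥0∞} (hv : v ≠ 0)
    (hvol : ∀ a ∈ S, volume (voronoiCell S a) = v) (R : ℝ) :
    (S ∩ Metric.closedBall (0 : Plane) R).Finite := by
  have hfin := Measure.finite_const_le_meas_of_disjoint_iUnion₀ volume
    (As := fun a : ↥(S ∩ Metric.closedBall (0 : Plane) R) => voronoiCell S (a : Plane))
    (pos_iff_ne_zero.2 hv) (fun a => (isClosed_voronoiCell S a).measurableSet.nullMeasurableSet)
    (fun a b hab => aedisjoint_voronoiCell a.2.1 b.2.1 (by rwa [Ne, Subtype.coe_inj]))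
    (ne_top_of_le_ne_top (measure_closedBall_lt_top (x := (0 : Plane)) (r := R + r)).ne
      (measure_mono (iUnion_subset fun a x hx => by
        have h1 := h.voronoiCell_subset hk a hx
        have h2 := a.2.2
        rw [Metric.mem_closedBall] at *
        linarith [dist_triangle x a 0])))
  have huniv : {a : ↥(S ∩ Metric.closedBall (0 : Plane) R) | v ≤ volume (voronoiCell S (a : Plane))} =
      univ := by
    ext a
    simp [hvol a a.2.1]
  rw [huniv, finite_univ_iff] at hfin
  exact toFinite _

/-- If all Voronoi cells have the same area, then the covering density is the ratio of the area of
a disk to the area of a cell. -/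
lemma IsFoldCovering.hasCoveringDensity {k : ℕ} {S : Set Plane} {r : ℝ}
    (h : IsFoldCovering k S r) (hk : k ≠ 0) {v : ℝ≥0∞} (hv : v ≠ 0)
    (hvol : ∀ a ∈ S, volume (voronoiCell S a) = v) :
    HasCoveringDensity S r (volume (Metric.closedBall (0 : Plane) r) / v) := by
  obtain ⟨c, hc, -⟩ := h.exists_dist_le hk 0
  refine tendsto_const_nhds.congr' ?_
  filter_upwards [eventually_ge_atTop ‖c‖] with R hR
  have hfin := h.finite_inter_closedBall hk hv hvol R
  have hcard : ENat.card ↥(S ∩ Metric.closedBall (0 : Plane) R) ≠ 0 := by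
    rw [Ne, ENat.card_eq_zero_iff_empty, isEmpty_coe_sort, ← Ne, ← nonempty_iff_ne_empty]
    exact ⟨c, hc, by simpa using hR⟩
  have hcard' : ENat.card ↥(S ∩ Metric.closedBall (0 : Plane) R) ≠ ⊤ := by
    have := hfin.to_subtype
    exact (ENat.card_lt_top_of_finite).ne
  unfold densityRatio
  rw [tsum_congr fun a : ↥(S ∩ Metric.closedBall (0 : Plane) R) => hvol a a.2.1,
    tsum_congr fun a : ↥(S ∩ Metric.closedBall (0 : Plane) R) =>
      Measure.addHaar_closedBall_center volume (a : Plane) r,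
    ENNReal.tsum_const, ENNReal.tsum_const, ENNReal.mul_div_mul_left]
  · simpa using hcard
  · simpa using hcard'

lemma HasCoveringDensity.unique {S : Set Plane} {r : ℝ} {D D' : ℝ≥0∞}
    (h : HasCoveringDensity S r D) (h' : HasCoveringDensity S r D') : D = D' :=
  tendsto_nhds_unique h h'

lemma volume_triangle_ne_zero {A B C : Plane} (h : AffineIndependent ℝ ![A, B, C]) :
    volume (convexHull ℝ {A, B, C}) ≠ 0 := by
  rw [affineIndependent_iff_doubleArea_ne_zero] at h
  rw [volume_triangle, Ne, ENNReal.ofReal_eq_zero, not_le]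
  positivity

/-! ### The constant `theta` -/

lemma segment_le_mem {s : Set Plane} (hs : Convex ℝ s) {x y z : Plane} (hx : x ∈ s) (hy : y ∈ s)
    {t : ℝ} (ht : 0 ≤ t) (ht' : t ≤ 1) (hz : z = (1 - t) • x + t • y) : z ∈ s :=
  hz ▸ hs hx hy (by linarith) ht (by ring)

/-- Horizontal slices make the area accessible to `volume_setOf_slices`. -/
lemma regularHexagon_eq : regularHexagon = {x : Plane | x 1 ∈ Icc (-(√3 / 2)) (√3 / 2) ∧
    x 0 ∈ Icc (-(1 - |x 1| / √3)) (1 - |x 1| / √3)} := by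
  have h3 : √3 ^ 2 = 3 := Real.sq_sqrt (by norm_num)
  have hs : 0 < √3 := by positivity
  have c2 : Real.cos (2 * (Real.pi / 3)) = -(1 / 2) := by
    rw [show 2 * (Real.pi / 3) = Real.pi - Real.pi / 3 by ring, Real.cos_pi_sub,
      Real.cos_pi_div_three]
  have s2 : Real.sin (2 * (Real.pi / 3)) = √3 / 2 := by
    rw [show 2 * (Real.pi / 3) = Real.pi - Real.pi / 3 by ring, Real.sin_pi_sub,
      Real.sin_pi_div_three]
  have c3 : Real.cos (3 * (Real.pi / 3)) = -1 := by
    rw [show 3 * (Real.pi / 3) = Real.pi by ring, Real.cos_pi]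
  have s3 : Real.sin (3 * (Real.pi / 3)) = 0 := by
    rw [show 3 * (Real.pi / 3) = Real.pi by ring, Real.sin_pi]
  have c4 : Real.cos (4 * (Real.pi / 3)) = -(1 / 2) := by
    rw [show 4 * (Real.pi / 3) = Real.pi / 3 + Real.pi by ring, Real.cos_add_pi,
      Real.cos_pi_div_three]
  have s4 : Real.sin (4 * (Real.pi / 3)) = -(√3 / 2) := by
    rw [show 4 * (Real.pi / 3) = Real.pi / 3 + Real.pi by ring, Real.sin_add_pi,
      Real.sin_pi_div_three]
  have c5 : Real.cos (5 * (Real.pi / 3)) = 1 / 2 := by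
    rw [show 5 * (Real.pi / 3) = 2 * Real.pi - Real.pi / 3 by ring, Real.cos_two_pi_sub,
      Real.cos_pi_div_three]
  have s5 : Real.sin (5 * (Real.pi / 3)) = -(√3 / 2) := by
    rw [show 5 * (Real.pi / 3) = 2 * Real.pi - Real.pi / 3 by ring, Real.sin_two_pi_sub,
      Real.sin_pi_div_three]
  have hrange : (range fun k : Fin 6 =>
      (!₂[Real.cos ((k : ℕ) * (Real.pi / 3)), Real.sin ((k : ℕ) * (Real.pi / 3))] : Plane)) =
      {!₂[1, 0], !₂[1 / 2, √3 / 2], !₂[-(1 / 2), √3 / 2], !₂[-1, 0], !₂[-(1 / 2), -(√3 / 2)],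
        !₂[1 / 2, -(√3 / 2)]} := by
    ext x
    simp only [mem_range, Fin.exists_fin_succ, Fin.val_zero, Fin.val_succ, mem_insert_iff,
      mem_singleton_iff]
    norm_num [c2, s2, c3, s3, c4, s4, c5, s5, eq_comm]
  rw [regularHexagon, hrange]
  have habs : ∀ x c : ℝ, |x| ≤ c ↔ x ≤ c ∧ -x ≤ c := fun x c => abs_le'
  have hbd : ∀ x y : ℝ, (x ∈ Icc (-(1 - |y| / √3)) (1 - |y| / √3)) ↔
      |y| ≤ √3 * (1 - x) ∧ |y| ≤ √3 * (1 + x) := by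
    intro x y
    rw [mem_Icc, ← mul_le_mul_iff_right₀ hs, ← mul_le_mul_iff_right₀ hs (b := x),
      show √3 * -(1 - |y| / √3) = |y| - √3 by field_simp; ring,
      show √3 * (1 - |y| / √3) = √3 - |y| by field_simp]
    constructor <;> rintro ⟨h1, h2⟩ <;> constructor <;> linarith
  simp only [hbd, habs, mem_Icc]
  apply subset_antisymm
  · apply convexHull_min
    · rintro x (rfl | rfl | rfl | rfl | rfl | rfl) <;>
        refine ⟨⟨?_, ?_⟩, ⟨?_, ?_⟩, ?_, ?_⟩ <;>
        simp only [Matrix.cons_val_zero, Matrix.cons_val_one] <;> linarith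
    · rintro x ⟨⟨h1, h2⟩, ⟨h3, h4⟩, h5, h6⟩ y ⟨⟨h1', h2'⟩, ⟨h3', h4'⟩, h5', h6'⟩ a b ha hb hab
      obtain rfl : a = 1 - b := by linarith
      simp only [mem_ofPred_eq, PiLp.add_apply, PiLp.smul_apply, smul_eq_mul]
      refine ⟨⟨?_, ?_⟩, ⟨?_, ?_⟩, ?_, ?_⟩ <;> nlinarith
  · rintro x ⟨⟨h1, h2⟩, ⟨h4, h5⟩, h6, h7⟩
    set H : Set Plane := {!₂[1, 0], !₂[1 / 2, √3 / 2], !₂[-(1 / 2), √3 / 2], !₂[-1, 0],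
      !₂[-(1 / 2), -(√3 / 2)], !₂[1 / 2, -(√3 / 2)]}
    have hc := convex_convexHull ℝ H
    have hH : ∀ y ∈ H, y ∈ convexHull ℝ H := subset_convexHull ℝ H
    -- `σ` selects the upper or lower half. The point lies on a horizontal chord whose ends divide
    -- the slanted edges in the ratio given by `2y/√3`.
    have key : ∀ σ y : ℝ, (σ = 1 ∨ σ = -1) → 0 ≤ y → y ≤ √3 / 2 → x 1 = σ * y →
        y ≤ √3 * (1 - x 0) → y ≤ √3 * (1 + x 0) → x ∈ convexHull ℝ H := by
      intro σ y hσ hy0 hy1 hxy hl hr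
      have ht0 : 0 ≤ 2 * y / √3 := by positivity
      have ht1 : 2 * y / √3 ≤ 1 := by rw [div_le_one hs]; linarith
      have hR : (!₂[1 - y / √3, σ * y] : Plane) ∈ convexHull ℝ H := by
        refine segment_le_mem hc (hH !₂[1, 0] (by simp [H]))
          (hH !₂[1 / 2, σ * (√3 / 2)] ?_) ht0 ht1 ?_
        · rcases hσ with rfl | rfl <;> simp [H]
        · ext i
          fin_cases i <;> simp <;> (field_simp; try ring)
      have hL : (!₂[-(1 - y / √3), σ * y] : Plane) ∈ convexHull ℝ H := by
        refine segment_le_mem hc (hH !₂[-1, 0] (by simp [H]))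
          (hH !₂[-(1 / 2), σ * (√3 / 2)] ?_) ht0 ht1 ?_
        · rcases hσ with rfl | rfl <;> simp [H]
        · ext i
          fin_cases i <;> simp <;> (field_simp; try ring)
      have hw : 0 < 1 - y / √3 := by
        have : 2 * y / √3 = 2 * (y / √3) := by ring
        linarith
      have hwl : y / √3 ≤ 1 - x 0 := by rw [div_le_iff₀ hs]; linarith
      have hwr : y / √3 ≤ 1 + x 0 := by rw [div_le_iff₀ hs]; linarith
      refine segment_le_mem hc hL hR (t := (x 0 + (1 - y / √3)) / (2 * (1 - y / √3)))
        (div_nonneg (by linarith) (by linarith)) ((div_le_one (by linarith)).2 (by linarith)) ?_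
      generalize y / √3 = u at hw
      ext i
      fin_cases i
      · simp; field_simp; ring
      · simp [hxy]; ring
    rcases le_total 0 (x 1) with h | h
    · exact key 1 (x 1) (Or.inl rfl) h h2 (by ring) (by linarith) (by linarith)
    · exact key (-1) (-x 1) (Or.inr rfl) (by linarith) (by linarith) (by ring) (by linarith)
        (by linarith)

lemma volume_regularHexagon : volume regularHexagon = ENNReal.ofReal (3 * √3 / 2) := by
  have h3 : √3 ^ 2 = 3 := Real.sq_sqrt (by norm_num)
  have hs : 0 < √3 := by positivity
  rw [regularHexagon_eq, volume_setOf_slices (a := -(√3 / 2)) (b := √3 / 2) (by linarith)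
    (f := fun y => -(1 - |y| / √3)) (g := fun y => 1 - |y| / √3) (by fun_prop) (by fun_prop)]
  · congr 1
    have hint : ∀ a b, IntervalIntegrable (fun y : ℝ => 1 - |y| / √3 - -(1 - |y| / √3)) volume a b :=
      fun a b => Continuous.intervalIntegrable (by fun_prop) a b
    rw [← intervalIntegral.integral_add_adjacent_intervals (hint _ 0) (hint 0 _)]
    have i1 : ∫ y in (-(√3 / 2))..0, (1 - |y| / √3 - -(1 - |y| / √3)) =
        ∫ y in (-(√3 / 2))..0, (2 + 2 / √3 * y) := by
      refine intervalIntegral.integral_congr fun y hy => ?_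
      rw [uIcc_of_le (by linarith)] at hy
      simp only [abs_of_nonpos hy.2]; ring
    have i2 : ∫ y in (0 : ℝ)..(√3 / 2), (1 - |y| / √3 - -(1 - |y| / √3)) =
        ∫ y in (0 : ℝ)..(√3 / 2), (2 - 2 / √3 * y) := by
      refine intervalIntegral.integral_congr fun y hy => ?_
      rw [uIcc_of_le (by linarith)] at hy
      simp only [abs_of_nonneg hy.1]; ring
    rw [i1, i2, intervalIntegral.integral_add (by simp)
      (Continuous.intervalIntegrable (by fun_prop) _ _), intervalIntegral.integral_sub (by simp)
      (Continuous.intervalIntegrable (by fun_prop) _ _)]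
    have hid : ∀ a b : ℝ, ∫ y in a..b, 2 / √3 * y = 2 / √3 * ((b ^ 2 - a ^ 2) / 2) := by
      intro a b
      rw [intervalIntegral.integral_const_mul, integral_id]
    rw [hid, hid]
    simp only [intervalIntegral.integral_const, smul_eq_mul]
    field_simp
    ring_nf
  · intro y hy
    have : |y| / √3 ≤ 1 := by
      rw [div_le_one hs]
      exact (abs_le.2 hy).trans (by linarith)
    linarith

lemma theta_eq : theta = 2 * Real.pi / (3 * √3) := by
  rw [theta, volume_regularHexagon, ENNReal.toReal_ofReal (by positivity)]
  field_simp

lemma two_mul_theta : 2 * theta = 4 * Real.pi / √27 := by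
  rw [theta_eq, show (27 : ℝ) = 3 ^ 2 * 3 by norm_num, Real.sqrt_mul (by norm_num),
    Real.sqrt_sq (by norm_num)]
  ring

/-- The denominator is the inscribed equilateral triangle, half the inscribed regular hexagon; this
is the factor 2. -/
lemma volume_closedBall_div_eq {r : ℝ} (hr : 0 < r) :
    volume (Metric.closedBall (0 : Plane) r) / ENNReal.ofReal (3 * √3 / 2 * r ^ 2 / 2) =
      ENNReal.ofReal (2 * theta) := by
  rw [EuclideanSpace.volume_closedBall_fin_two, ← ENNReal.ofReal_pow hr.le,
    ← ENNReal.ofReal_mul (by positivity), ← ENNReal.ofReal_div_of_pos (by positivity), theta_eq]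
  congr 1
  field_simp

/-! ### Equilateral Johnson patterns -/

/-- The common circumradius fixes the side at `√3 r`, so cells of different centres are congruent
and of known area. -/
lemma IsEquilateralJohnsonPattern.exists_dist_sq {S : Set Plane} {r : ℝ}
    (h : IsEquilateralJohnsonPattern S r) {a : Plane} (ha : a ∈ S) :
    ∃ A B C : Plane, AffineIndependent ℝ ![A, B, C] ∧ voronoiCell S a = convexHull ℝ {A, B, C} ∧
      dist A B ^ 2 = 3 * r ^ 2 ∧ dist B C ^ 2 = 3 * r ^ 2 ∧ dist C A ^ 2 = 3 * r ^ 2 := by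
  obtain ⟨A, B, C, -, -, -, -, -, -, -, hi, hcell, h₁, h₂, hA, hB, hC, -⟩ := h a ha
  have := dist_sq_eq_of_equilateral_inscribed hi h₁ h₂ hA hB hC
  exact ⟨A, B, C, hi, hcell, this, h₁ ▸ this, h₂ ▸ h₁ ▸ this⟩

lemma IsEquilateralJohnsonPattern.hasCongruentVoronoiTriangles {S : Set Plane} {r : ℝ}
    (hr : 0 < r) (h : IsEquilateralJohnsonPattern S r) : HasCongruentVoronoiTriangles S := by
  refine ⟨fun a ha => ?_, fun a ha b hb => ?_⟩
  · obtain ⟨A, B, C, hi, hcell, -⟩ := h.exists_dist_sq ha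
    exact ⟨A, B, C, hi, hcell⟩
  · obtain ⟨A, B, C, -, hcell, h₁, h₂, h₃⟩ := h.exists_dist_sq ha
    obtain ⟨A', B', C', -, hcell', h₁', h₂', h₃'⟩ := h.exists_dist_sq hb
    rw [hcell, hcell']
    exact areCongruent_of_equilateral (by positivity) h₁ h₂ h₃ h₁' h₂' h₃'

lemma IsEquilateralJohnsonPattern.hasCoveringDensity {S : Set Plane} {r : ℝ} (hr : 0 < r)
    (hcov : IsFoldCovering 2 S r) (h : IsEquilateralJohnsonPattern S r) :
    HasCoveringDensity S r (ENNReal.ofReal (2 * theta)) := by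
  rw [← volume_closedBall_div_eq hr]
  refine hcov.hasCoveringDensity two_ne_zero ?_ fun a ha => ?_
  · rw [Ne, ENNReal.ofReal_eq_zero, not_le]; positivity
  · obtain ⟨A, B, C, -, hcell, h₁, h₂, h₃⟩ := h.exists_dist_sq ha
    rw [hcell, volume_triangle, abs_doubleArea_of_equilateral h₁ h₂ h₃]
    congr 1; ring

/-! ### Coverings with congruent Voronoi triangles -/

lemma HasCongruentVoronoiTriangles.exists_density {S : Set Plane} {r : ℝ} (hr : 0 < r)
    (hcov : IsFoldCovering 2 S r) (h : HasCongruentVoronoiTriangles S) :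
    ∃ D : ℝ≥0∞, HasCoveringDensity S r D ∧ ENNReal.ofReal (2 * theta) ≤ D := by
  obtain ⟨a, ha, -⟩ := hcov.exists_dist_le two_ne_zero 0
  obtain ⟨A, B, C, hi, hcell⟩ := h.1 a ha
  have hsub := hcov.voronoiCell_subset two_ne_zero a
  refine ⟨_, hcov.hasCoveringDensity two_ne_zero (v := volume (voronoiCell S a)) ?_
    fun b hb => (h.2 b hb a ha).volume_eq, ?_⟩
  · rw [hcell]
    exact volume_triangle_ne_zero hi
  · rw [← volume_closedBall_div_eq hr]
    refine ENNReal.div_le_div_left ?_ _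
    have hmem : ∀ x ∈ ({A, B, C} : Set Plane), dist x a ≤ r := fun x hx =>
      hsub (hcell ▸ subset_convexHull ℝ _ hx)
    rw [hcell, volume_triangle]
    have := abs_doubleArea_le (hmem A (by simp)) (hmem B (by simp)) (hmem C (by simp))
    exact ENNReal.ofReal_le_ofReal (by linarith)

/-! ### The honeycomb pattern -/

/-- The point with coordinates `s`, `t` in the basis of the triangular lattice of side `r`. -/
noncomputable def triangularPoint (r s t : ℝ) : Plane :=
  !₂[r * (s + t / 2), r * (√3 / 2 * t)]

/-- The triangular lattice of side `r` without one of its three classes: the vertices of the tiling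
of the plane by regular hexagons of side `r`. -/
def honeycomb (r : ℝ) : Set Plane :=
  {x | ∃ i j : ℤ, ¬(3 : ℤ) ∣ i - j ∧ x = triangularPoint r i j}

lemma exists_eq_triangularPoint {r : ℝ} (hr : 0 < r) (x : Plane) :
    ∃ s t : ℝ, x = triangularPoint r s t := by
  have hs : 0 < √3 := by positivity
  refine ⟨x 0 / r - x 1 / (r * √3), 2 * x 1 / (r * √3), ?_⟩
  ext i
  fin_cases i <;> simp [triangularPoint] <;> field_simp
  ring

/-- The basis vectors have length `r` and enclose 60°, so distances reduce to the form `s² + st +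
t²`, which is integral on the lattice. -/
lemma dist_sq_triangularPoint (r s t s' t' : ℝ) :
    dist (triangularPoint r s t) (triangularPoint r s' t') ^ 2 =
      r ^ 2 * ((s - s') ^ 2 + (s - s') * (t - t') + (t - t') ^ 2) := by
  have h3 : √3 ^ 2 = 3 := Real.sq_sqrt (by norm_num)
  rw [dist_sq_eq]
  simp only [triangularPoint, Matrix.cons_val_zero, Matrix.cons_val_one]
  linear_combination r ^ 2 * (t - t') ^ 2 / 4 * h3

lemma dist_triangularPoint_le_iff {r : ℝ} (hr : 0 < r) (s t s' t' u v u' v' : ℝ) :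
    dist (triangularPoint r s t) (triangularPoint r s' t') ≤
        dist (triangularPoint r u v) (triangularPoint r u' v') ↔
      (s - s') ^ 2 + (s - s') * (t - t') + (t - t') ^ 2 ≤
        (u - u') ^ 2 + (u - u') * (v - v') + (v - v') ^ 2 := by
  rw [← sq_le_sq₀ dist_nonneg dist_nonneg, dist_sq_triangularPoint, dist_sq_triangularPoint,
    mul_le_mul_iff_right₀ (by positivity)]

lemma dist_triangularPoint_le {r s t s' t' : ℝ} (hr : 0 < r)
    (h : (s - s') ^ 2 + (s - s') * (t - t') + (t - t') ^ 2 ≤ 1) :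
    dist (triangularPoint r s t) (triangularPoint r s' t') ≤ r := by
  rw [← sq_le_sq₀ dist_nonneg hr.le, dist_sq_triangularPoint]
  nlinarith [sq_nonneg r]

lemma dist_triangularPoint_eq {r s t s' t' : ℝ} (hr : 0 < r)
    (h : (s - s') ^ 2 + (s - s') * (t - t') + (t - t') ^ 2 = 1) :
    dist (triangularPoint r s t) (triangularPoint r s' t') = r := by
  rw [← sq_eq_sq₀ dist_nonneg hr.le, dist_sq_triangularPoint, h, mul_one]

lemma triangularPoint_ne {r s t s' t' : ℝ} (hr : 0 < r)
    (h : 0 < (s - s') ^ 2 + (s - s') * (t - t') + (t - t') ^ 2) :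
    triangularPoint r s t ≠ triangularPoint r s' t' := by
  intro heq
  have hd := dist_sq_triangularPoint r s t s' t'
  rw [heq, dist_self] at hd
  have := mul_pos (pow_pos hr 2) h
  linarith

/-- Squared distances to two centres have the same quadratic part, so each condition cuts out a
half-plane or the whole plane. -/
lemma convex_voronoiCell (S : Set Plane) (a : Plane) : Convex ℝ (voronoiCell S a) := by
  intro x hx y hy s t hs ht hst b hb
  have h1 := hx b hb
  have h2 := hy b hb
  rw [dist_le_dist_iff] at *
  obtain rfl : s = 1 - t := by linarith
  simp only [PiLp.add_apply, PiLp.smul_apply, smul_eq_mul]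
  nlinarith [mul_le_mul_of_nonneg_left h1 hs, mul_le_mul_of_nonneg_left h2 ht]

/-- Lattice points of different colours are at least `r` apart. The form is integral and `4(u² + uv
+ v²) = (2u + v)² + 3v²`, so it is below 1 only at the origin. -/
lemma Int.one_le_sq_add_mul_add_sq {u v : ℤ} (h : ¬(3 : ℤ) ∣ u - v) :
    1 ≤ u ^ 2 + u * v + v ^ 2 := by
  by_contra! hlt
  have hv : v = 0 := by
    have : 3 * v ^ 2 ≤ 0 := by nlinarith [sq_nonneg (2 * u + v)]
    exact pow_eq_zero_iff two_ne_zero |>.1 (le_antisymm (by linarith) (sq_nonneg v))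
  subst hv
  have hu : u = 0 := pow_eq_zero_iff two_ne_zero |>.1 (le_antisymm (by linarith) (sq_nonneg u))
  subst hu
  exact h (by simp)

/-- A removed lattice point belongs to the Voronoi cells of its neighbours. -/
lemma triangularPoint_mem_voronoiCell {r : ℝ} (hr : 0 < r) {i j m n : ℤ} (hmn : (3 : ℤ) ∣ m - n)
    (h : (m - i) ^ 2 + (m - i) * (n - j) + (n - j) ^ 2 = 1) :
    triangularPoint r m n ∈ voronoiCell (honeycomb r) (triangularPoint r i j) := by
  rintro _ ⟨k, l, hkl, rfl⟩
  rw [dist_triangularPoint_le_iff hr]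
  have := Int.one_le_sq_add_mul_add_sq (u := m - k) (v := n - l) (by omega)
  rw [← h] at this
  exact_mod_cast this

lemma voronoiCell_honeycomb {r : ℝ} (hr : 0 < r) {i j ε : ℤ} (hε : ε = 1 ∨ ε = -1)
    (hij : (3 : ℤ) ∣ i - j - ε) :
    voronoiCell (honeycomb r) (triangularPoint r i j) = convexHull ℝ
      {triangularPoint r (i - ε : ℤ) j, triangularPoint r i (j + ε : ℤ),
        triangularPoint r (i + ε : ℤ) (j - ε : ℤ)} := by
  have hε2 : ε ^ 2 = 1 := by rcases hε with rfl | rfl <;> norm_num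
  apply subset_antisymm
  · intro x hx
    obtain ⟨s, t, rfl⟩ := exists_eq_triangularPoint hr x
    have h1 := hx (triangularPoint r (i + ε : ℤ) j) ⟨_, _, by omega, rfl⟩
    have h2 := hx (triangularPoint r i (j - ε : ℤ)) ⟨_, _, by omega, rfl⟩
    have h3 := hx (triangularPoint r (i - ε : ℤ) (j + ε : ℤ)) ⟨_, _, by omega, rfl⟩
    rw [dist_triangularPoint_le_iff hr] at h1 h2 h3
    have hεR : (ε : ℝ) ^ 2 = 1 := by exact_mod_cast hε2
    push_cast at h1 h2 h3
    rw [mem_convexHull_triple]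
    -- The barycentric coordinates are one third of the slacks in the bisector inequalities of the
    -- three remaining neighbours: `h2` and `h3` for these two, `h1` for the third.
    refine ⟨(1 + ε * (s - i + 2 * (t - j))) / 3, (1 + ε * (s - i - (t - j))) / 3, ?_, ?_, ?_, ?_⟩
    · nlinarith
    · nlinarith
    · nlinarith
    · ext k
      fin_cases k
      · simp [triangularPoint]
        linear_combination (-r * (s - i + (t - j) / 2)) * hεR
      · simp [triangularPoint]
        linear_combination (-r * √3 / 2 * (t - j)) * hεR
  · refine convexHull_min ?_ (convex_voronoiCell _ _)
    rintro x (rfl | rfl | rfl)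
    · exact triangularPoint_mem_voronoiCell hr (by omega) (by linear_combination hε2)
    · exact triangularPoint_mem_voronoiCell hr (by omega) (by linear_combination hε2)
    · exact triangularPoint_mem_voronoiCell hr (by omega) (by linear_combination hε2)

lemma sphere_inter_sphere_eq_pair {c c' P Q : Plane} {r : ℝ} (hc : c ≠ c') (hPQ : P ≠ Q)
    (h₁ : dist P c = r) (h₂ : dist Q c = r) (h₃ : dist P c' = r) (h₄ : dist Q c' = r) :
    Metric.sphere c r ∩ Metric.sphere c' r = {P, Q} := by
  ext x
  constructor
  · rintro ⟨hx, hx'⟩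
    exact EuclideanGeometry.eq_of_dist_eq_of_dist_eq_of_finrank_eq_two (by simp) hc hPQ h₁ h₂ hx
      h₃ h₄ hx'
  · rintro (rfl | rfl)
    · exact ⟨h₁, h₃⟩
    · exact ⟨h₂, h₄⟩

lemma isEquilateralJohnsonPattern_honeycomb {r : ℝ} (hr : 0 < r) :
    IsEquilateralJohnsonPattern (honeycomb r) r := by
  rintro _ ⟨i, j, hij, rfl⟩
  obtain ⟨ε, hε, hdvd⟩ : ∃ ε : ℤ, (ε = 1 ∨ ε = -1) ∧ (3 : ℤ) ∣ i - j - ε := by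
    rcases (by omega : (3 : ℤ) ∣ i - j - 1 ∨ (3 : ℤ) ∣ i - j - -1) with h | h
    · exact ⟨1, Or.inl rfl, h⟩
    · exact ⟨-1, Or.inr rfl, h⟩
  have hε2 : (ε : ℝ) ^ 2 = 1 := by rcases hε with rfl | rfl <;> norm_num
  have hε0 : (ε : ℝ) ≠ 0 := by rintro h; simp [h] at hε2
  have hs : √3 ≠ 0 := by positivity
  -- `Q` is the centre itself; each `cₖ` is the reflection in `Q` of the corresponding vertex of the
  -- cell.
  refine ⟨_, _, _, triangularPoint r i j,
    triangularPoint r (i + ε : ℤ) j, ⟨_, _, by omega, rfl⟩,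
    triangularPoint r i (j - ε : ℤ), ⟨_, _, by omega, rfl⟩,
    triangularPoint r (i - ε : ℤ) (j + ε : ℤ), ⟨_, _, by omega, rfl⟩,
    ?_, voronoiCell_honeycomb hr hε hdvd, ?_, ?_, ?_, ?_, ?_, ?_, ?_, ?_, ?_, ?_, ?_⟩
  · rw [affineIndependent_iff_doubleArea_ne_zero]
    have : doubleArea (triangularPoint r (i - ε : ℤ) j) (triangularPoint r i (j + ε : ℤ))
        (triangularPoint r (i + ε : ℤ) (j - ε : ℤ)) = -(3 * √3 / 2 * r ^ 2) * ε ^ 2 := by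
      simp [doubleArea, triangularPoint]
      ring
    rw [this, hε2]
    simp [hs, hr.ne']
  · rw [← sq_eq_sq₀ dist_nonneg dist_nonneg, dist_sq_triangularPoint, dist_sq_triangularPoint]
    push_cast; ring
  · rw [← sq_eq_sq₀ dist_nonneg dist_nonneg, dist_sq_triangularPoint, dist_sq_triangularPoint]
    push_cast; ring
  · exact dist_triangularPoint_eq hr (by push_cast; linear_combination hε2)
  · exact dist_triangularPoint_eq hr (by push_cast; linear_combination hε2)
  · exact dist_triangularPoint_eq hr (by push_cast; linear_combination hε2)
  · exact triangularPoint_ne hr (by push_cast; nlinarith)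
  · exact triangularPoint_ne hr (by push_cast; nlinarith)
  · exact triangularPoint_ne hr (by push_cast; nlinarith)
  all_goals
    refine sphere_inter_sphere_eq_pair (triangularPoint_ne hr ?_) (triangularPoint_ne hr ?_)
      (dist_triangularPoint_eq hr ?_) (dist_triangularPoint_eq hr ?_)
      (dist_triangularPoint_eq hr ?_) (dist_triangularPoint_eq hr ?_) <;> push_cast <;> nlinarith

lemma isFoldCovering_honeycomb {r : ℝ} (hr : 0 < r) : IsFoldCovering 2 (honeycomb r) r := by
  intro x
  obtain ⟨s, t, rfl⟩ := exists_eq_triangularPoint hr x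
  -- The third divisibility condition says that the two lattice points differ in colour, hence are
  -- distinct.
  have two : ∀ i j k l : ℤ, ¬(3 : ℤ) ∣ i - j → ¬(3 : ℤ) ∣ k - l → ¬(3 : ℤ) ∣ (i - k) - (j - l) →
      (s - i) ^ 2 + (s - i) * (t - j) + (t - j) ^ 2 ≤ 1 →
      (s - k) ^ 2 + (s - k) * (t - l) + (t - l) ^ 2 ≤ 1 →
      ((2 : ℕ) : ℕ∞) ≤ {a : Plane | a ∈ honeycomb r ∧
        triangularPoint r s t ∈ Metric.closedBall a r}.encard := by
    intro i j k l hij hkl hne h1 h2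
    have hne' : triangularPoint r i j ≠ triangularPoint r k l := by
      have := Int.one_le_sq_add_mul_add_sq hne
      refine triangularPoint_ne hr ?_
      exact_mod_cast this
    rw [Nat.cast_ofNat, ← encard_pair hne']
    refine encard_le_encard ?_
    rintro _ (rfl | rfl)
    · exact ⟨⟨i, j, hij, rfl⟩, dist_triangularPoint_le hr h1⟩
    · exact ⟨⟨k, l, hkl, rfl⟩, dist_triangularPoint_le hr h2⟩
  -- of the three vertices of a lattice triangle containing the point, two lie in the honeycomb
  obtain ⟨u, hu⟩ : ∃ u, s - ⌊s⌋ = u := ⟨_, rfl⟩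
  obtain ⟨v, hv⟩ : ∃ v, t - ⌊t⌋ = v := ⟨_, rfl⟩
  have hu0 : 0 ≤ u := by linarith [Int.floor_le s]
  have hv0 : 0 ≤ v := by linarith [Int.floor_le t]
  have hu1 : u ≤ 1 := by linarith [Int.lt_floor_add_one s]
  have hv1 : v ≤ 1 := by linarith [Int.lt_floor_add_one t]
  generalize ⌊s⌋ = i at *
  generalize ⌊t⌋ = j at *
  obtain rfl : s = u + i := by linarith
  obtain rfl : t = v + j := by linarith
  -- The diagonal `u + v = 1` cuts the lattice parallelogram into two triangles; `(δ, δ)` is the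
  -- vertex off the diagonal on the side of the point.
  have hP : ∃ δ : ℤ, (u - δ) ^ 2 + (u - δ) * (v - δ) + (v - δ) ^ 2 ≤ 1 ∧
      (u - 1) ^ 2 + (u - 1) * v + v ^ 2 ≤ 1 ∧ u ^ 2 + u * (v - 1) + (v - 1) ^ 2 ≤ 1 := by
    rcases le_total (u + v) 1 with h | h
    · exact ⟨0, by push_cast; nlinarith, by nlinarith, by nlinarith⟩
    · exact ⟨1, by push_cast; nlinarith, by nlinarith, by nlinarith⟩
  obtain ⟨δ, h0, h1, h2⟩ := hP
  -- The vertices `(i + δ, j + δ)`, `(i + 1, j)`, `(i, j + 1)` have colours `i - j`, `i - j + 1`, `i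
  -- - j - 1`; the one of colour 0 is dropped.
  rcases (by omega : (i - j) % 3 = 0 ∨ (i - j) % 3 = 1 ∨ (i - j) % 3 = 2) with h | h | h
  · refine two (i + 1) j i (j + 1) (by omega) (by omega) (by omega) ?_ ?_ <;> push_cast <;> linarith
  · refine two (i + δ) (j + δ) (i + 1) j (by omega) (by omega) (by omega) ?_ ?_ <;> push_cast <;>
      linarith
  · refine two (i + δ) (j + δ) i (j + 1) (by omega) (by omega) (by omega) ?_ ?_ <;> push_cast <;>
      linarith

theorem lemma2 :
    2 * theta = 4 * Real.pi / Real.sqrt 27 ∧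
    ∀ r : ℝ, 0 < r →
      (∀ S : Set Plane, IsFoldCovering 2 S r → HasCongruentVoronoiTriangles S →
        ∃ D : ℝ≥0∞, HasCoveringDensity S r D) ∧
      IsLeast {D : ℝ≥0∞ | ∃ S : Set Plane, IsFoldCovering 2 S r ∧
          HasCongruentVoronoiTriangles S ∧ HasCoveringDensity S r D}
        (ENNReal.ofReal (2 * theta)) ∧
      (∃ S : Set Plane, IsFoldCovering 2 S r ∧ HasCongruentVoronoiTriangles S ∧
        IsEquilateralJohnsonPattern S r) ∧
      (∀ S : Set Plane, IsFoldCovering 2 S r → IsEquilateralJohnsonPattern S r →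
        HasCongruentVoronoiTriangles S ∧
          HasCoveringDensity S r (ENNReal.ofReal (2 * theta))) := by
  refine ⟨two_mul_theta, fun r hr => ?_⟩
  have hcov := isFoldCovering_honeycomb hr
  have hJ := isEquilateralJohnsonPattern_honeycomb hr
  refine ⟨fun S hS h => ?_, ⟨⟨honeycomb r, hcov, hJ.hasCongruentVoronoiTriangles hr,
    hJ.hasCoveringDensity hr hcov⟩, ?_⟩, ⟨honeycomb r, hcov, hJ.hasCongruentVoronoiTriangles hr, hJ⟩,
    fun S hS h => ⟨h.hasCongruentVoronoiTriangles hr, h.hasCoveringDensity hr hS⟩⟩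
  · obtain ⟨D, hD, -⟩ := h.exists_density hr hS
    exact ⟨D, hD⟩
  · rintro D ⟨S, hS, h, hD⟩
    obtain ⟨D', hD', hle⟩ := h.exists_density hr hS
    rwa [hD.unique hD']
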